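/- Let $q:\mathbb R\to\mathbb R$ be an even function in $L^1_{loc}(\mathbb R)$ such that $\tau_q(y)=-y''-qy$ is in the limit circle case at $+\infty$ and at $-\infty$, that is, for every $\lambda\in\mathbb C$ all solutions of $\tau_q(y)-\lambda y=0$ are square integrable near $+\infty$ and near $-\infty$. Let $\mathcal D_{\max}=\{y\in L^2(\mathbb R): y,y'\in AC_{loc}(\mathbb R),\ \tau_q(y)\in L^2(\mathbb R)\}$ and let $A_{\max}y=\tau_q(y)$ for $y\in\mathcal D_{\max}$ be the maximal operator in $L^2(\mathbb R)$. Write $[f,g]_x=\overline{f(x)}g'(x)-\overline{f'(x)}g(x)$ and $[f,g]_{\pm\infty}=\lim_{x\to\pm\infty}[f,g]_x$. Let $w_1,w_2$ be real valued solutions of $\tau_q(y)=0$ with $w_1$ odd, $w_2$ even and $[w_1,w_2]_{-\infty}=[w_1,w_2]_{\infty}=1$, and for $f\in\mathcal D_{\max}$ put $\alpha_j(f)=[w_j,f]_{-\infty}$, $\beta_j(f)=[w_j,f]_{\infty}$, $j=1,2$. Below, $\widetilde A$ is always the restriction of $A_{\max}$ to the $f\in\mathcal D_{\max}$ that satisfy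 the stated boundary conditions. (1) (Separated boundary conditions.) Let $\widetilde A$ be given by $$\alpha_1(f)\,\xi\cos\alpha-\alpha_2(f)\sin\alpha=0,\qquad \beta_1(f)\,\eta\cos\beta-\beta_2(f)\sin\beta=0,$$ where $\xi,\eta\in\mathbb C$, $|\xi|=|\eta|=1$ and $\alpha,\beta\in[0,2\pi)$. Then $\widetilde A=\widetilde A^*$ if and only if ($\xi=\pm1$ or $\sin\alpha\cos\alpha=0$) and ($\eta=\pm1$ or $\sin\beta\cos\beta=0$). In particular, call $(\xi,\alpha)$ normalized if $\xi\neq-1$, and $\xi=1$ in case $\sin\alpha\cos\alpha=0$. If $(\xi,\alpha)$ and $(\eta,\beta)$ are normalized, then $\widetilde A=\widetilde A^*$ if and only if $\xi=\eta=1$. Moreover, every extension given by separated boundary conditions $a\,\alpha_1(f)+b\,\alpha_2(f)=0$, $c\,\beta_1(f)+d\,\beta_2(f)=0$ with $a,b,c,d\in\mathbb C$, $(a,b)\ne(0,0)$, $(c,d)\neq(0,0)$ is equal to the one given by such $\xi,\eta,\alpha,\beta$ with $(\xi,\alpha)$ and $(\eta,\beta)$ normalized. (2) (Mixed boundary conditions.)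 Let $a,b,c,d\in\mathbb C$, let $\widetilde A$ be given by $$\begin{pmatrix}\alpha_1(f)\\ \alpha_2(f)\end{pmatrix}=\begin{bmatrix}a&b\\c&d\end{bmatrix}\begin{pmatrix}\beta_1(f)\\ \beta_2(f)\end{pmatrix}\qquad\text{or by}\qquad \begin{pmatrix}\beta_1(f)\\ \beta_2(f)\end{pmatrix}=\begin{bmatrix}a&b\\c&d\end{bmatrix}\begin{pmatrix}\alpha_1(f)\\ \alpha_2(f)\end{pmatrix},$$ and set $\Delta=ad-bc$. In either case $\widetilde A=\widetilde A^*$ if and only if for some $\varphi\in\mathbb R$ we have $\Delta=e^{2i\varphi}$ and $e^{-i\varphi}a,\ e^{-i\varphi}b,\ e^{-i\varphi}c,\ e^{-i\varphi}d\in\mathbb R$. -/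

import Mathlib

open MeasureTheory Filter Topology

noncomputable section

namespace SturmLiouville

/-- The Hilbert space `L²(ℝ)` of (classes of) complex valued functions. -/
abbrev L2 : Type := Lp ℂ 2 (volume : Measure ℝ)

/-- `AC_loc(ℝ)`: absolutely continuous on all compact intervals. -/
def LocAC (y : ℝ → ℂ) : Prop :=
  ∀ a b : ℝ, AbsolutelyContinuousOnInterval y a b

/-- `y, y' ∈ AC_loc(ℝ)`.  As `y'` is then continuous and `y` is an integral of `y'`, this means
that `y` is differentiable everywhere with `y' ∈ AC_loc(ℝ)`; conversely such a `y` is continuously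
differentiable, hence itself in `AC_loc(ℝ)`, see `Regular.locAC`. -/
structure Regular (y : ℝ → ℂ) : Prop where
  differentiable : Differentiable ℝ y
  locAC_deriv : LocAC (deriv y)

/-- The differential expression `τ_q(y) = -y'' - q y` (defined almost everywhere). -/
def tau (q : ℝ → ℝ) (y : ℝ → ℂ) : ℝ → ℂ :=
  fun x => -deriv (deriv y) x - (q x : ℂ) * y x

/-- `y` is a solution on `ℝ` of `τ_q(y) - l y = 0`. -/
structure IsSolution (q : ℝ → ℝ) (l : ℂ) (y : ℝ → ℂ) : Prop where
  regular : Regular y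
  eq : ∀ᵐ x, tau q y x - l * y x = 0

/-- `τ_q` is in the limit circle case at `+∞` and at `-∞`. -/
def LimitCircle (q : ℝ → ℝ) : Prop :=
  ∀ (l : ℂ) (y : ℝ → ℂ), IsSolution q l y →
    (∃ a : ℝ, MemLp y 2 (volume.restrict (Set.Ioi a))) ∧
    (∃ a : ℝ, MemLp y 2 (volume.restrict (Set.Iio a)))

/-- The maximal domain `D_max`, as a set of functions. -/
structure MaxDomain (q : ℝ → ℝ) (y : ℝ → ℂ) : Prop where
  regular : Regular y
  memLp : MemLp y 2 volume
  memLp_tau : MemLp (tau q y) 2 volume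

/-- `[f,g]_x = conj (f x) g'(x) - conj (f' x) g(x)`. -/
def bracket (f g : ℝ → ℂ) (x : ℝ) : ℂ :=
  star (f x) * deriv g x - star (deriv f x) * g x

/-- `w₁, w₂` are real valued solutions of `τ_q(y) = 0`, `w₁` is odd, `w₂` is even and
`[w₁,w₂]_{-∞} = [w₁,w₂]_∞ = 1`.  (Under `LimitCircle` they belong to `D_max`; that `[w_j,w_j]_{±∞}`
vanishes follows since they are real valued.) -/
structure IsSolutionPair (q : ℝ → ℝ) (w₁ w₂ : ℝ → ℂ) : Prop where
  solution₁ : IsSolution q 0 w₁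
  solution₂ : IsSolution q 0 w₂
  real₁ : ∀ x, (w₁ x).im = 0
  real₂ : ∀ x, (w₂ x).im = 0
  odd₁ : ∀ x, w₁ (-x) = -w₁ x
  even₂ : ∀ x, w₂ (-x) = w₂ x
  bracket_bot : Tendsto (bracket w₁ w₂) atBot (𝓝 1)
  bracket_top : Tendsto (bracket w₁ w₂) atTop (𝓝 1)

/-- `z = ((α₁(f), α₂(f)), (β₁(f), β₂(f)))`, where `α_j(f) = [w_j,f]_{-∞}`, `β_j(f) = [w_j,f]_∞`
are the limits of `[w_j,f]_x` as `x → -∞` and as `x → ∞`. -/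
structure HasBoundaryValues (w₁ w₂ f : ℝ → ℂ) (z : (Fin 2 → ℂ) × (Fin 2 → ℂ)) : Prop where
  alpha₁ : Tendsto (bracket w₁ f) atBot (𝓝 (z.1 0))
  alpha₂ : Tendsto (bracket w₂ f) atBot (𝓝 (z.1 1))
  beta₁ : Tendsto (bracket w₁ f) atTop (𝓝 (z.2 0))
  beta₂ : Tendsto (bracket w₂ f) atTop (𝓝 (z.2 1))

/-! ### Linearity and uniqueness facts needed for the definitions below -/

theorem LocAC.continuous {y : ℝ → ℂ} (h : LocAC y) : Continuous y := by
  rw [continuous_iff_continuousAt]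
  intro x
  refine (h (x - 1) (x + 1)).continuousOn.continuousAt ?_
  rw [Set.uIcc_of_le (by linarith)]
  exact Icc_mem_nhds (by linarith) (by linarith)

theorem Regular.locAC {y : ℝ → ℂ} (h : Regular y) : LocAC y := by
  intro a b
  have : ContDiff ℝ 1 y := contDiff_one_iff_deriv.2 ⟨h.differentiable, h.locAC_deriv.continuous⟩
  exact this.contDiffOn.absolutelyContinuousOnInterval

theorem LocAC.ae_differentiableAt {y : ℝ → ℂ} (h : LocAC y) :
    ∀ᵐ x : ℝ, DifferentiableAt ℝ y x := by
  refine LocallyBoundedVariationOn.ae_differentiableAt ?_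
  intro a b _ _
  refine (h a b).boundedVariationOn.mono ?_
  intro x hx
  exact Set.Icc_subset_uIcc hx.2

theorem Regular.zero : Regular (0 : ℝ → ℂ) := by
  have h0 : deriv (0 : ℝ → ℂ) = fun _ => 0 := by
    funext x
    exact deriv_const x (0 : ℂ)
  refine ⟨differentiable_const _, ?_⟩
  rw [h0]
  intro a b
  exact (contDiff_const (𝕜 := ℝ) (n := 1) (c := (0 : ℂ))).contDiffOn.absolutelyContinuousOnInterval

theorem Regular.deriv_add {y z : ℝ → ℂ} (hy : Regular y) (hz : Regular z) :
    deriv (y + z) = deriv y + deriv z := by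
  funext x
  exact _root_.deriv_add (hy.differentiable x) (hz.differentiable x)

theorem Regular.deriv_smul {y : ℝ → ℂ} (hy : Regular y) (c : ℂ) :
    deriv (c • y) = c • deriv y := by
  funext x
  exact ((hy.differentiable x).hasDerivAt.const_smul c).deriv

theorem Regular.add {y z : ℝ → ℂ} (hy : Regular y) (hz : Regular z) : Regular (y + z) := by
  refine ⟨hy.differentiable.add hz.differentiable, ?_⟩
  rw [hy.deriv_add hz]
  intro a b
  exact (hy.locAC_deriv a b).add (hz.locAC_deriv a b)

theorem Regular.smul {y : ℝ → ℂ} (hy : Regular y) (c : ℂ) : Regular (c • y) := by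
  refine ⟨hy.differentiable.const_smul c, ?_⟩
  rw [hy.deriv_smul]
  intro a b
  exact (hy.locAC_deriv a b).const_smul c

theorem tau_add {q : ℝ → ℝ} {y z : ℝ → ℂ} (hy : Regular y) (hz : Regular z) :
    tau q (y + z) =ᵐ[volume] tau q y + tau q z := by
  filter_upwards [hy.locAC_deriv.ae_differentiableAt, hz.locAC_deriv.ae_differentiableAt]
    with x h1 h2
  simp only [tau, hy.deriv_add hz, Pi.add_apply]
  rw [_root_.deriv_add h1 h2]
  ring

theorem tau_smul {q : ℝ → ℝ} {y : ℝ → ℂ} (hy : Regular y) (c : ℂ) :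
    tau q (c • y) =ᵐ[volume] c • tau q y := by
  filter_upwards [hy.locAC_deriv.ae_differentiableAt] with x h1
  simp only [tau, hy.deriv_smul, Pi.smul_apply, smul_eq_mul]
  rw [(h1.hasDerivAt.const_smul c).deriv, smul_eq_mul]
  ring

theorem MaxDomain.zero (q : ℝ → ℝ) : MaxDomain q (0 : ℝ → ℂ) := by
  refine ⟨Regular.zero, MemLp.zero, ?_⟩
  have h := tau_smul (q := q) Regular.zero (0 : ℂ)
  rw [zero_smul, zero_smul] at h
  exact MemLp.zero.ae_eq h.symm

theorem tau_zero (q : ℝ → ℝ) : tau q 0 =ᵐ[volume] 0 := by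
  have h := tau_smul (q := q) Regular.zero (0 : ℂ)
  rwa [zero_smul, zero_smul] at h

theorem MaxDomain.add {q : ℝ → ℝ} {y z : ℝ → ℂ} (hy : MaxDomain q y) (hz : MaxDomain q z) :
    MaxDomain q (y + z) :=
  ⟨hy.regular.add hz.regular, hy.memLp.add hz.memLp,
    (hy.memLp_tau.add hz.memLp_tau).ae_eq (tau_add hy.regular hz.regular).symm⟩

theorem MaxDomain.smul {q : ℝ → ℝ} {y : ℝ → ℂ} (hy : MaxDomain q y) (c : ℂ) :
    MaxDomain q (c • y) :=
  ⟨hy.regular.smul c, hy.memLp.const_smul c,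
    (hy.memLp_tau.const_smul c).ae_eq (tau_smul hy.regular c).symm⟩

theorem bracket_add {w y z : ℝ → ℂ} (hy : Regular y) (hz : Regular z) :
    bracket w (y + z) = bracket w y + bracket w z := by
  funext x
  simp only [bracket, hy.deriv_add hz, Pi.add_apply]
  ring

theorem bracket_smul {w y : ℝ → ℂ} (hy : Regular y) (c : ℂ) :
    bracket w (c • y) = c • bracket w y := by
  funext x
  simp only [bracket, hy.deriv_smul, Pi.smul_apply, smul_eq_mul]
  ring

theorem bracket_zero (w : ℝ → ℂ) : bracket w 0 = 0 := by
  have h := bracket_smul (w := w) Regular.zero (0 : ℂ)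
  rwa [zero_smul, zero_smul] at h

/-! ### The operators -/

/-- The graph of the maximal operator. -/
def maxGraph (q : ℝ → ℝ) : Submodule ℂ (L2 × L2) where
  carrier := {p | ∃ y : ℝ → ℂ, MaxDomain q y ∧ p.1 =ᵐ[volume] y ∧ p.2 =ᵐ[volume] tau q y}
  zero_mem' := ⟨0, MaxDomain.zero q, Lp.coeFn_zero _ _ _,
    (Lp.coeFn_zero ℂ 2 volume).trans (tau_zero q).symm⟩
  add_mem' := by
    rintro ⟨u, u'⟩ ⟨v, v'⟩ ⟨y, hy, hu, hu'⟩ ⟨z, hz, hv, hv'⟩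
    exact ⟨y + z, hy.add hz, (Lp.coeFn_add u v).trans (hu.add hv),
      ((Lp.coeFn_add u' v').trans (hu'.add hv')).trans (tau_add hy.regular hz.regular).symm⟩
  smul_mem' := by
    rintro c ⟨u, u'⟩ ⟨y, hy, hu, hu'⟩
    exact ⟨c • y, hy.smul c, (Lp.coeFn_smul c u).trans (hu.const_smul c),
      ((Lp.coeFn_smul c u').trans (hu'.const_smul c)).trans (tau_smul hy.regular c).symm⟩

/-- The maximal operator `A_max`: domain `D_max`, `A_max y = τ_q(y)`. -/
def maxOp (q : ℝ → ℝ) : L2 →ₗ.[ℂ] L2 := (maxGraph q).toLinearPMap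

/-- `maxGraph` is the graph of an operator, so that `maxOp` does not take a default value. -/
theorem maxOp_graph (q : ℝ → ℝ) : (maxOp q).graph = maxGraph q := by
  refine Submodule.toLinearPMap_graph_eq _ ?_
  rintro ⟨u, u'⟩ ⟨y, hy, hu, hu'⟩ h0
  simp only at h0 hu hu' ⊢
  subst h0
  have hy0 : y = 0 := by
    refine (Continuous.ae_eq_iff_eq volume hy.regular.differentiable.continuous
      continuous_zero).1 ?_
    exact hu.symm.trans (Lp.coeFn_zero _ _ _)
  subst hy0
  exact (Lp.eq_zero_iff_ae_eq_zero).2 (hu'.trans (tau_zero q))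

/-- The elements of `D_max` whose boundary values lie in the subspace `B` of `ℂ² × ℂ²`. -/
def boundaryDomain (q : ℝ → ℝ) (w₁ w₂ : ℝ → ℂ) (B : Submodule ℂ ((Fin 2 → ℂ) × (Fin 2 → ℂ))) :
    Submodule ℂ L2 where
  carrier := {u | ∃ y : ℝ → ℂ, MaxDomain q y ∧ u =ᵐ[volume] y ∧
    ∃ z ∈ B, HasBoundaryValues w₁ w₂ y z}
  zero_mem' := by
    refine ⟨0, MaxDomain.zero q, Lp.coeFn_zero _ _ _, 0, B.zero_mem, ?_⟩
    constructor <;> rw [bracket_zero] <;> exact tendsto_const_nhds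
  add_mem' := by
    rintro u v ⟨y, hy, hu, z, hz, h⟩ ⟨y', hy', hv, z', hz', h'⟩
    refine ⟨y + y', hy.add hy', (Lp.coeFn_add u v).trans (hu.add hv), z + z',
      B.add_mem hz hz', ?_⟩
    constructor <;> rw [bracket_add hy.regular hy'.regular]
    exacts [h.alpha₁.add h'.alpha₁, h.alpha₂.add h'.alpha₂, h.beta₁.add h'.beta₁,
      h.beta₂.add h'.beta₂]
  smul_mem' := by
    rintro c u ⟨y, hy, hu, z, hz, h⟩
    refine ⟨c • y, hy.smul c, (Lp.coeFn_smul c u).trans (hu.const_smul c), c • z,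
      B.smul_mem c hz, ?_⟩
    constructor <;> rw [bracket_smul hy.regular]
    exacts [h.alpha₁.const_smul c, h.alpha₂.const_smul c, h.beta₁.const_smul c,
      h.beta₂.const_smul c]

/-- The extension `Ã`: the restriction of `A_max` to the functions in `D_max` with boundary values
in `B`. -/
def extension (q : ℝ → ℝ) (w₁ w₂ : ℝ → ℂ) (B : Submodule ℂ ((Fin 2 → ℂ) × (Fin 2 → ℂ))) :
    L2 →ₗ.[ℂ] L2 :=
  (maxOp q).domRestrict (boundaryDomain q w₁ w₂ B)

/-! ### The boundary conditions -/

/-- Separated boundary conditions `a α₁ + b α₂ = 0`, `c β₁ + d β₂ = 0`. -/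
def separatedBC (a b c d : ℂ) : Submodule ℂ ((Fin 2 → ℂ) × (Fin 2 → ℂ)) where
  carrier := {z | a * z.1 0 + b * z.1 1 = 0 ∧ c * z.2 0 + d * z.2 1 = 0}
  zero_mem' := by simp
  add_mem' := by
    rintro z z' ⟨h1, h2⟩ ⟨h1', h2'⟩
    refine ⟨?_, ?_⟩ <;> simp only [Prod.fst_add, Prod.snd_add, Pi.add_apply]
    · linear_combination h1 + h1'
    · linear_combination h2 + h2'
  smul_mem' := by
    rintro t z ⟨h1, h2⟩
    refine ⟨?_, ?_⟩ <;> simp only [Prod.smul_fst, Prod.smul_snd, Pi.smul_apply, smul_eq_mul]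
    · linear_combination t * h1
    · linear_combination t * h2

/-- Separated boundary conditions `α₁ ξ cos α - α₂ sin α = 0`, `β₁ η cos β - β₂ sin β = 0`. -/
def normSeparatedBC (ξ η : ℂ) (α β : ℝ) : Submodule ℂ ((Fin 2 → ℂ) × (Fin 2 → ℂ)) :=
  separatedBC (ξ * (Real.cos α : ℂ)) (-(Real.sin α : ℂ))
    (η * (Real.cos β : ℂ)) (-(Real.sin β : ℂ))

/-- Mixed boundary conditions `(α₁, α₂)ᵀ = M (β₁, β₂)ᵀ`. -/
def mixedBC₁ (M : Matrix (Fin 2) (Fin 2) ℂ) : Submodule ℂ ((Fin 2 → ℂ) × (Fin 2 → ℂ)) where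
  carrier := {z | z.1 = M.mulVec z.2}
  zero_mem' := (Matrix.mulVec_zero M).symm
  add_mem' := by
    rintro z z' (h : z.1 = _) (h' : z'.1 = _)
    show (z + z').1 = M.mulVec (z + z').2
    rw [Prod.fst_add, Prod.snd_add, Matrix.mulVec_add, h, h']
  smul_mem' := by
    rintro t z (h : z.1 = _)
    show (t • z).1 = M.mulVec (t • z).2
    rw [Prod.smul_fst, Prod.smul_snd, Matrix.mulVec_smul, h]

/-- Mixed boundary conditions `(β₁, β₂)ᵀ = M (α₁, α₂)ᵀ`. -/
def mixedBC₂ (M : Matrix (Fin 2) (Fin 2) ℂ) : Submodule ℂ ((Fin 2 → ℂ) × (Fin 2 → ℂ)) where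
  carrier := {z | z.2 = M.mulVec z.1}
  zero_mem' := (Matrix.mulVec_zero M).symm
  add_mem' := by
    rintro z z' (h : z.2 = _) (h' : z'.2 = _)
    show (z + z').2 = M.mulVec (z + z').1
    rw [Prod.fst_add, Prod.snd_add, Matrix.mulVec_add, h, h']
  smul_mem' := by
    rintro t z (h : z.2 = _)
    show (t • z).2 = M.mulVec (t • z).1
    rw [Prod.smul_fst, Prod.smul_snd, Matrix.mulVec_smul, h]

/-- The pair `(ξ, α)` is normalized: `ξ = 1` where the condition does not determine `ξ` up to sign
(that is, where `cos α = 0` or `sin α = 0`), and `ξ ≠ -1` (note that `(-ξ, 2π - α)` gives the same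
condition as `(ξ, α)`). -/
def Normalized (ξ : ℂ) (α : ℝ) : Prop :=
  (Real.sin α * Real.cos α = 0 → ξ = 1) ∧ ξ ≠ -1

/-- For some real `φ`: `Δ = ad - bc = e^{2iφ}` and `e^{-iφ}a, e^{-iφ}b, e^{-iφ}c, e^{-iφ}d` are
real. -/
def MixedCriterion (a b c d : ℂ) : Prop :=
  ∃ φ : ℝ, a * d - b * c = Complex.exp (2 * Complex.I * φ) ∧
    (∃ r : ℝ, Complex.exp (-Complex.I * φ) * a = r) ∧
    (∃ r : ℝ, Complex.exp (-Complex.I * φ) * b = r) ∧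
    (∃ r : ℝ, Complex.exp (-Complex.I * φ) * c = r) ∧
    (∃ r : ℝ, Complex.exp (-Complex.I * φ) * d = r)

end SturmLiouville

end

noncomputable section

namespace SturmLiouville

/-! ### Locally absolutely continuous functions -/

/-! The question reduces to linear algebra on the boundary values `z = (α, β)` in `ℂ² × ℂ²`. For `f,
g` in `D_max` Green's formula reads `⟨A f, g⟩ - ⟨f, A g⟩ = [f,g]_∞ - [f,g]_{-∞}`. Since the
Wronskian of `w₁, w₂` is 1, the right side is a skew-Hermitian form in the boundary values of `f`
and `g`, `boundaryForm` (`IsSolutionPair.green`).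

Variation of constants (`IsSolutionPair.exists_tau_eq`) solves `τ_q(y) = F` in `D_max` for every `F`
in `L²`, with `α = 0` and `β_j = -⟨w_j, F⟩`. Three facts follow: every boundary value is attained,
since `w₁ ⊥ w₂` by parity; the orthogonal complement of the range of the minimal operator is spanned
by `w₁, w₂`; every extension is densely defined. Hence the adjoint of the extension given by `B` is
the one given by the complement of `B` under the form (`IsSolutionPair.mem_adjoint_graph`), and
self-adjointness means that `B` equals its complement, that is, `B` is Lagrangian
(`IsSolutionPair.isSelfAdjoint_extension_iff`).

Separated conditions give a product of two lines, which is Lagrangian exactly when each line has a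
real spanning vector. Mixed conditions give the graph of a matrix `M`, which is Lagrangian exactly
when `M* J M = J` with `J = [[0, 1], [-1, 0]]`; such `M` are the unimodular multiples of real
matrices of determinant 1. -/

theorem LocAC.const (c : ℂ) : LocAC fun _ => c := fun _ _ =>
  (contDiff_const (𝕜 := ℝ) (n := 1) (c := c)).contDiffOn.absolutelyContinuousOnInterval

theorem LocAC.add {f g : ℝ → ℂ} (hf : LocAC f) (hg : LocAC g) : LocAC fun x => f x + g x :=
  fun a b => (hf a b).add (hg a b)

theorem LocAC.sub {f g : ℝ → ℂ} (hf : LocAC f) (hg : LocAC g) : LocAC fun x => f x - g x :=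
  fun a b => (hf a b).sub (hg a b)

theorem LocAC.mul {f g : ℝ → ℂ} (hf : LocAC f) (hg : LocAC g) : LocAC fun x => f x * g x :=
  fun a b => (hf a b).smul (hg a b)

theorem LocAC.star {f : ℝ → ℂ} (hf : LocAC f) : LocAC fun x => star (f x) := by
  intro a b
  have h := hf a b
  rw [absolutelyContinuousOnInterval_iff] at h ⊢
  simpa only [dist_star_star] using h

theorem locAC_ofReal_integral {g : ℝ → ℝ} (hg : LocallyIntegrable g volume) (c : ℝ) :
    LocAC fun x => ((∫ t in c..x, g t : ℝ) : ℂ) := by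
  intro a b
  -- The interval is enlarged so that it contains the base point `c` as well as `a` and `b`.
  have h := ((hg.integrableOn_isCompact isCompact_uIcc).intervalIntegrable
    (a := min (min a b) c) (b := max (max a b) c)).absolutelyContinuousOnInterval_intervalIntegral (c := c)
    (by rw [Set.uIcc_of_le (by simp)]; simp)
  have h2 := (h.smul (LocAC.const 1 _ _)).mono (c := a) (d := b) (by
    rw [Set.uIcc_of_le (a := min (min a b) c) (by simp)]
    intro x hx
    rw [Set.uIcc, Set.mem_Icc] at hx
    exact ⟨(min_le_left _ _).trans hx.1, hx.2.trans (le_max_left _ _)⟩)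
  have e : (fun x => ((∫ t in c..x, g t : ℝ) : ℂ)) = (fun x => ∫ t in c..x, g t) • fun _ => 1 := by
    funext x
    simp
  rw [e]
  exact h2

theorem intervalIntegrable_ofReal {g : ℝ → ℝ} {a b : ℝ} (hg : IntervalIntegrable g volume a b) :
    IntervalIntegrable (fun x => (g x : ℂ)) volume a b :=
  ⟨hg.1.ofReal, hg.2.ofReal⟩

theorem locAC_integral {g : ℝ → ℂ} (hg : LocallyIntegrable g volume) (c : ℝ) :
    LocAC fun x => ∫ t in c..x, g t := by
  have hre : LocallyIntegrable (fun x => (g x).re) volume := fun x => (hg x).imp fun s hs =>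
    ⟨hs.1, hs.2.re⟩
  have him : LocallyIntegrable (fun x => (g x).im) volume := fun x => (hg x).imp fun s hs =>
    ⟨hs.1, hs.2.im⟩
  have h := (locAC_ofReal_integral hre c).add
    ((LocAC.const Complex.I).mul (locAC_ofReal_integral him c))
  convert h using 2 with x
  rw [← intervalIntegral.integral_ofReal, ← intervalIntegral.integral_ofReal,
    ← intervalIntegral.integral_const_mul, ← intervalIntegral.integral_add]
  · congr 1
    funext t
    rw [mul_comm]
    exact (Complex.re_add_im _).symm
  · exact (intervalIntegrable_ofReal (hre.integrableOn_isCompact isCompact_uIcc).intervalIntegrable)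
  · exact (intervalIntegrable_ofReal (him.integrableOn_isCompact isCompact_uIcc).intervalIntegrable).const_mul _

/-- The fundamental theorem of calculus for locally absolutely continuous functions. -/
theorem LocAC.integral_eq_sub {f g : ℝ → ℂ} (hf : LocAC f) (hg : LocallyIntegrable g volume)
    (h : ∀ᵐ x, HasDerivAt f (g x) x) (a b : ℝ) : ∫ t in a..b, g t = f b - f a := by
  -- The difference of `f` and the integral of `g` is absolutely continuous with derivative zero
  -- almost everywhere, hence constant.
  obtain ⟨C, hC⟩ := (hf.sub (locAC_integral hg a) a b).const_of_ae_hasDerivAt_zero (by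
    filter_upwards [h, LocallyIntegrable.ae_hasDerivAt_integral hg] with x h1 h2 _
    rw [← sub_self (g x)]
    exact h1.sub (h2 a))
  have ha := hC a Set.left_mem_uIcc
  have hb := hC b Set.right_mem_uIcc
  rw [intervalIntegral.integral_same] at ha
  linear_combination ha - hb

/-- A locally absolutely continuous function whose derivative agrees almost everywhere with a
continuous function is differentiable everywhere. -/
theorem LocAC.hasDerivAt {f g : ℝ → ℂ} (hf : LocAC f) (hg : Continuous g)
    (h : ∀ᵐ x, HasDerivAt f (g x) x) (x : ℝ) : HasDerivAt f (g x) x := by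
  have h1 : f = fun y => (∫ t in (0 : ℝ)..y, g t) + f 0 := by
    funext y
    rw [hf.integral_eq_sub hg.locallyIntegrable h 0 y]
    ring
  rw [h1]
  exact (hg.integral_hasStrictDerivAt 0 x).hasDerivAt.add_const _

theorem LocAC.tendsto_of_integrable {f g : ℝ → ℂ} (hf : LocAC f) (hg : Integrable g volume)
    (h : ∀ᵐ x, HasDerivAt f (g x) x) :
    (∃ l, Tendsto f atBot (𝓝 l)) ∧ ∃ l, Tendsto f atTop (𝓝 l) := by
  have h1 : f = fun y => f 0 + (∫ t in (0 : ℝ)..y, g t) := by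
    funext y
    rw [hf.integral_eq_sub hg.locallyIntegrable h 0 y]
    ring
  have h2 : f = fun y => f 0 - (∫ t in y..(0 : ℝ), g t) := by
    funext y
    rw [hf.integral_eq_sub hg.locallyIntegrable h y 0]
    ring
  constructor
  · rw [h2]
    exact ⟨_, tendsto_const_nhds.sub
      (intervalIntegral_tendsto_integral_Iic 0 hg.integrableOn tendsto_id)⟩
  · rw [h1]
    exact ⟨_, tendsto_const_nhds.add
      (intervalIntegral_tendsto_integral_Ioi 0 hg.integrableOn tendsto_id)⟩

theorem LocAC.integral_eq_of_tendsto {f g : ℝ → ℂ} (hf : LocAC f) (hg : Integrable g volume)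
    (h : ∀ᵐ x, HasDerivAt f (g x) x) {l m : ℂ} (hl : Tendsto f atBot (𝓝 l))
    (hm : Tendsto f atTop (𝓝 m)) : ∫ x, g x = m - l := by
  have h1 := intervalIntegral_tendsto_integral hg (tendsto_neg_atTop_atBot (G := ℝ)) tendsto_id
  have h2 : Tendsto (fun x : ℝ => f x - f (-x)) atTop (𝓝 (m - l)) :=
    hm.sub (hl.comp tendsto_neg_atTop_atBot)
  refine tendsto_nhds_unique h1 (h2.congr fun x => ?_)
  exact (hf.integral_eq_sub hg.locallyIntegrable h (-x) x).symm

/-! ### The bracket and Green's formula -/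

theorem locAC_bracket {f g : ℝ → ℂ} (hf : Regular f) (hg : Regular g) : LocAC (bracket f g) :=
  (hf.locAC.star.mul hg.locAC_deriv).sub (hf.locAC_deriv.star.mul hg.locAC)

/-- The products of first derivatives cancel, and so do the potential terms, because `q` is real. -/
theorem ae_hasDerivAt_bracket (q : ℝ → ℝ) {f g : ℝ → ℂ} (hf : Regular f) (hg : Regular g) :
    ∀ᵐ x, HasDerivAt (bracket f g) (star (tau q f x) * g x - star (f x) * tau q g x) x := by
  filter_upwards [hf.locAC_deriv.ae_differentiableAt, hg.locAC_deriv.ae_differentiableAt]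
    with x h1 h2
  have hf1 := (hf.differentiable x).hasDerivAt
  have hg1 := (hg.differentiable x).hasDerivAt
  have h := (hf1.star.mul h2.hasDerivAt).sub (h1.hasDerivAt.star.mul hg1)
  have e : star (tau q f x) * g x - star (f x) * tau q g x =
      star (deriv f x) * deriv g x + star (f x) * deriv (deriv g) x -
        (star (deriv (deriv f) x) * g x + star (deriv f x) * deriv g x) := by
    simp only [tau, RCLike.star_def, map_sub, map_neg, map_mul, Complex.conj_ofReal]
    ring
  rw [e]
  exact h

theorem integrable_star_mul {f g : ℝ → ℂ} (hf : MemLp f 2 volume) (hg : MemLp g 2 volume) :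
    Integrable (fun x => star (f x) * g x) volume :=
  hf.star.integrable_mul hg

theorem MaxDomain.integrable_green {q : ℝ → ℝ} {f g : ℝ → ℂ} (hf : MaxDomain q f)
    (hg : MaxDomain q g) :
    Integrable (fun x => star (tau q f x) * g x - star (f x) * tau q g x) volume :=
  (integrable_star_mul hf.memLp_tau hg.memLp).sub (integrable_star_mul hf.memLp hg.memLp_tau)

/-- The derivative of the bracket is a difference of products of `L²` functions, hence integrable
over the whole line. -/
theorem MaxDomain.tendsto_bracket {q : ℝ → ℝ} {f g : ℝ → ℂ} (hf : MaxDomain q f)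
    (hg : MaxDomain q g) :
    (∃ l, Tendsto (bracket f g) atBot (𝓝 l)) ∧ ∃ l, Tendsto (bracket f g) atTop (𝓝 l) :=
  (locAC_bracket hf.regular hg.regular).tendsto_of_integrable (hf.integrable_green hg)
    (ae_hasDerivAt_bracket q hf.regular hg.regular)

theorem inner_eq_integral {u v : L2} {f g : ℝ → ℂ} (hu : u =ᵐ[volume] f) (hv : v =ᵐ[volume] g) :
    inner ℂ u v = ∫ x, star (f x) * g x := by
  rw [L2.inner_def]
  refine integral_congr_ae ?_
  filter_upwards [hu, hv] with x h1 h2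
  rw [h1, h2, RCLike.inner_apply, mul_comm]
  rfl

/-- Green's formula. -/
theorem MaxDomain.green {q : ℝ → ℝ} {f g : ℝ → ℂ} (hf : MaxDomain q f) (hg : MaxDomain q g)
    {u u' v v' : L2} (hu : u =ᵐ[volume] f) (hu' : u' =ᵐ[volume] tau q f) (hv : v =ᵐ[volume] g)
    (hv' : v' =ᵐ[volume] tau q g) {l m : ℂ} (hl : Tendsto (bracket f g) atBot (𝓝 l))
    (hm : Tendsto (bracket f g) atTop (𝓝 m)) :
    inner ℂ u' v - inner ℂ u v' = m - l := by
  rw [inner_eq_integral hu' hv, inner_eq_integral hu hv',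
    ← integral_sub (integrable_star_mul hf.memLp_tau hg.memLp)
      (integrable_star_mul hf.memLp hg.memLp_tau)]
  exact (locAC_bracket hf.regular hg.regular).integral_eq_of_tendsto (hf.integrable_green hg)
    (ae_hasDerivAt_bracket q hf.regular hg.regular) hl hm

/-! ### The solutions `w₁`, `w₂` -/

theorem IsSolution.tau_ae_eq {q : ℝ → ℝ} {w : ℝ → ℂ} (h : IsSolution q 0 w) :
    tau q w =ᵐ[volume] 0 := by
  filter_upwards [h.eq] with x hx
  simpa using hx

theorem memLp_of_tails {y : ℝ → ℂ} (hy : Continuous y)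
    (h1 : ∃ a : ℝ, MemLp y 2 (volume.restrict (Set.Ioi a)))
    (h2 : ∃ a : ℝ, MemLp y 2 (volume.restrict (Set.Iio a))) : MemLp y 2 volume := by
  obtain ⟨a, ha⟩ := h1
  obtain ⟨b, hb⟩ := h2
  rw [memLp_two_iff_integrable_sq_norm hy.aestronglyMeasurable] at ha hb ⊢
  have hc : IntegrableOn (fun x => ‖y x‖ ^ 2) (Set.Icc b a) volume :=
    (hy.norm.pow 2).continuousOn.integrableOn_Icc
  have hb' : IntegrableOn (fun x => ‖y x‖ ^ 2) (Set.Iio b) volume := hb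
  rw [← integrableOn_univ]
  refine ((hb'.union hc).union ha).mono_set fun x _ => ?_
  rcases lt_or_ge x b with h | h
  · exact Or.inl (Or.inl h)
  · rcases le_or_gt x a with h' | h'
    · exact Or.inl (Or.inr ⟨h, h'⟩)
    · exact Or.inr h'

theorem IsSolution.maxDomain {q : ℝ → ℝ} {w : ℝ → ℂ} (h : IsSolution q 0 w)
    (hlc : LimitCircle q) : MaxDomain q w :=
  ⟨h.regular, memLp_of_tails h.regular.locAC.continuous (hlc 0 w h).1 (hlc 0 w h).2,
    MemLp.zero.ae_eq h.tau_ae_eq.symm⟩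

variable {q : ℝ → ℝ} {w₁ w₂ : ℝ → ℂ}

theorem star_eq_of_im {w : ℝ → ℂ} (h : ∀ x, (w x).im = 0) (x : ℝ) : star (w x) = w x :=
  Complex.conj_eq_iff_im.2 (h x)

theorem star_deriv_eq_of_im {w : ℝ → ℂ} (hd : Differentiable ℝ w) (h : ∀ x, (w x).im = 0) (x : ℝ) :
    star (deriv w x) = deriv w x := by
  have h1 := (hd x).hasDerivAt.star
  simp only [star_eq_of_im h] at h1
  exact h1.unique (hd x).hasDerivAt

theorem bracket_of_real {w : ℝ → ℂ} (hd : Differentiable ℝ w) (h : ∀ x, (w x).im = 0)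
    (f : ℝ → ℂ) (x : ℝ) : bracket w f x = w x * deriv f x - deriv w x * f x := by
  rw [bracket, star_eq_of_im h, star_deriv_eq_of_im hd h]

theorem IsSolution.bracket_const {f g : ℝ → ℂ} (hf : IsSolution q 0 f) (hg : IsSolution q 0 g)
    (a b : ℝ) : bracket f g a = bracket f g b := by
  have h : ∀ᵐ x, HasDerivAt (bracket f g) 0 x := by
    filter_upwards [ae_hasDerivAt_bracket q hf.regular hg.regular, hf.tau_ae_eq, hg.tau_ae_eq]
      with x hx h1 h2
    rw [h1, h2] at hx
    simpa using hx
  have := (locAC_bracket hf.regular hg.regular).integral_eq_sub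
    (g := fun _ => 0) (integrable_zero ℝ ℂ volume).locallyIntegrable h a b
  rw [intervalIntegral.integral_zero] at this
  linear_combination this

theorem IsSolutionPair.bracket_eq_one (hw : IsSolutionPair q w₁ w₂) (x : ℝ) :
    bracket w₁ w₂ x = 1 := by
  refine tendsto_nhds_unique (tendsto_const_nhds.congr fun y => ?_) hw.bracket_top
  exact hw.solution₁.bracket_const hw.solution₂ x y

theorem IsSolutionPair.wronskian (hw : IsSolutionPair q w₁ w₂) (x : ℝ) :
    w₁ x * deriv w₂ x - deriv w₁ x * w₂ x = 1 := by
  rw [← bracket_of_real hw.solution₁.regular.differentiable hw.real₁, hw.bracket_eq_one]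

/-- A Plücker identity: the right side is `[f,g]_x` times the Wronskian of `w₁, w₂`, which is 1. -/
theorem IsSolutionPair.bracket_eq (hw : IsSolutionPair q w₁ w₂) (f g : ℝ → ℂ) (x : ℝ) :
    bracket f g x = star (bracket w₁ f x) * bracket w₂ g x -
      star (bracket w₂ f x) * bracket w₁ g x := by
  have h := hw.wronskian x
  have e1 := star_eq_of_im hw.real₁ x
  have e2 := star_eq_of_im hw.real₂ x
  have e3 := star_deriv_eq_of_im hw.solution₁.regular.differentiable hw.real₁ x
  have e4 := star_deriv_eq_of_im hw.solution₂.regular.differentiable hw.real₂ x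
  simp only [bracket, star_sub, star_mul', e1, e2, e3, e4]
  linear_combination (-(star (f x) * deriv g x - star (deriv f x) * g x)) * h

/-! ### Boundary values and the boundary form -/

theorem MaxDomain.exists_boundaryValues {y : ℝ → ℂ} (hy : MaxDomain q y) (h₁ : MaxDomain q w₁)
    (h₂ : MaxDomain q w₂) : ∃ z, HasBoundaryValues w₁ w₂ y z := by
  obtain ⟨⟨a, ha⟩, ⟨b, hb⟩⟩ := h₁.tendsto_bracket hy
  obtain ⟨⟨c, hc⟩, ⟨d, hd⟩⟩ := h₂.tendsto_bracket hy
  exact ⟨(![a, c], ![b, d]), ha, hc, hb, hd⟩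

theorem HasBoundaryValues.unique {y : ℝ → ℂ} {z z' : (Fin 2 → ℂ) × (Fin 2 → ℂ)}
    (h : HasBoundaryValues w₁ w₂ y z) (h' : HasBoundaryValues w₁ w₂ y z') : z = z' := by
  refine Prod.ext (funext fun i => ?_) (funext fun i => ?_) <;> fin_cases i
  · exact tendsto_nhds_unique h.alpha₁ h'.alpha₁
  · exact tendsto_nhds_unique h.alpha₂ h'.alpha₂
  · exact tendsto_nhds_unique h.beta₁ h'.beta₁
  · exact tendsto_nhds_unique h.beta₂ h'.beta₂

theorem HasBoundaryValues.add {y y' : ℝ → ℂ} {z z' : (Fin 2 → ℂ) × (Fin 2 → ℂ)}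
    (hy : Regular y) (hy' : Regular y')
    (h : HasBoundaryValues w₁ w₂ y z) (h' : HasBoundaryValues w₁ w₂ y' z') :
    HasBoundaryValues w₁ w₂ (y + y') (z + z') := by
  constructor <;> rw [bracket_add hy hy']
  exacts [h.alpha₁.add h'.alpha₁, h.alpha₂.add h'.alpha₂, h.beta₁.add h'.beta₁,
    h.beta₂.add h'.beta₂]

theorem HasBoundaryValues.smul {y : ℝ → ℂ} {z : (Fin 2 → ℂ) × (Fin 2 → ℂ)}
    (hy : Regular y) (c : ℂ) (h : HasBoundaryValues w₁ w₂ y z) :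
    HasBoundaryValues w₁ w₂ (c • y) (c • z) := by
  constructor <;> rw [bracket_smul hy]
  exacts [h.alpha₁.const_smul c, h.alpha₂.const_smul c, h.beta₁.const_smul c,
    h.beta₂.const_smul c]

/-- The skew-Hermitian form on the boundary values that occurs in Green's formula. -/
def boundaryForm (z z' : (Fin 2 → ℂ) × (Fin 2 → ℂ)) : ℂ :=
  (star (z.2 0) * z'.2 1 - star (z.2 1) * z'.2 0) -
    (star (z.1 0) * z'.1 1 - star (z.1 1) * z'.1 0)

/-- Green's formula in terms of the boundary values. -/
theorem IsSolutionPair.green (hw : IsSolutionPair q w₁ w₂) {f g : ℝ → ℂ} (hf : MaxDomain q f)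
    (hg : MaxDomain q g) {u u' v v' : L2} (hu : u =ᵐ[volume] f) (hu' : u' =ᵐ[volume] tau q f)
    (hv : v =ᵐ[volume] g) (hv' : v' =ᵐ[volume] tau q g) {z z' : (Fin 2 → ℂ) × (Fin 2 → ℂ)}
    (hz : HasBoundaryValues w₁ w₂ f z) (hz' : HasBoundaryValues w₁ w₂ g z') :
    inner ℂ u' v - inner ℂ u v' = boundaryForm z z' := by
  refine hf.green hg hu hu' hv hv' ?_ ?_ <;>
    rw [show bracket f g = _ from funext (hw.bracket_eq f g)]
  · exact (hz.alpha₁.star.mul hz'.alpha₂).sub (hz.alpha₂.star.mul hz'.alpha₁)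
  · exact (hz.beta₁.star.mul hz'.beta₂).sub (hz.beta₂.star.mul hz'.beta₁)

/-! ### Variation of constants and attainability of boundary values -/

theorem memLp_mul_of_bounded {w P : ℝ → ℂ} (hw : MemLp w 2 volume) (hP : Continuous P)
    {C : ℝ} (hC : ∀ x, ‖P x‖ ≤ C) : MemLp (fun x => w x * P x) 2 volume := by
  refine hw.of_le_mul (c := C) (hw.1.mul hP.aestronglyMeasurable) (Eventually.of_forall fun x => ?_)
  rw [norm_mul, mul_comm]
  exact mul_le_mul_of_nonneg_right (hC x) (norm_nonneg _)

/-- A locally absolutely continuous antiderivative of an integrable function, vanishing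
at `-∞`. -/
theorem exists_primitive {g : ℝ → ℂ} (hg : Integrable g volume) :
    ∃ P : ℝ → ℂ, LocAC P ∧ (∀ᵐ x, HasDerivAt P (g x) x) ∧ (∃ C, ∀ x, ‖P x‖ ≤ C) ∧
      Tendsto P atBot (𝓝 0) ∧ Tendsto P atTop (𝓝 (∫ x, g x)) := by
  have hP := locAC_integral hg.locallyIntegrable 0
  have hP' : ∀ᵐ x, HasDerivAt (fun x => ∫ t in (0 : ℝ)..x, g t) (g x) x := by
    filter_upwards [LocallyIntegrable.ae_hasDerivAt_integral hg.locallyIntegrable] with x hx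
      using hx 0
  obtain ⟨⟨l, hl⟩, m, hm⟩ := hP.tendsto_of_integrable hg hP'
  refine ⟨fun x => (∫ t in (0 : ℝ)..x, g t) - l, hP.sub (LocAC.const l), ?_,
    ⟨(∫ x, ‖g x‖) + ‖l‖, fun x => ?_⟩, ?_, ?_⟩
  · filter_upwards [hP'] with x hx using hx.sub_const l
  · refine (norm_sub_le _ _).trans (add_le_add_left ?_ _)
    refine intervalIntegral.norm_integral_le_integral_norm_uIoc.trans ?_
    exact setIntegral_le_integral hg.norm (Eventually.of_forall fun _ => norm_nonneg _)
  · simpa using hl.sub_const l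
  · rw [hP.integral_eq_of_tendsto hg hP' hl hm]
    exact hm.sub_const l

/-- Variation of constants. -/
theorem IsSolutionPair.exists_tau_eq (hw : IsSolutionPair q w₁ w₂) (h₁ : MaxDomain q w₁)
    (h₂ : MaxDomain q w₂) {u₁ u₂ : L2} (hu₁ : u₁ =ᵐ[volume] w₁) (hu₂ : u₂ =ᵐ[volume] w₂) (F : L2) :
    ∃ y : ℝ → ℂ, MaxDomain q y ∧ F =ᵐ[volume] tau q y ∧
      HasBoundaryValues w₁ w₂ y (0, ![-inner ℂ u₁ F, -inner ℂ u₂ F]) := by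
  have hr₁ := star_eq_of_im hw.real₁
  have hr₂ := star_eq_of_im hw.real₂
  have hi₁ := integrable_star_mul h₁.memLp (Lp.memLp F)
  have hi₂ := integrable_star_mul h₂.memLp (Lp.memLp F)
  obtain ⟨P₁, hP₁, hd₁, ⟨C₁, hC₁⟩, hb₁, ht₁⟩ := exists_primitive hi₁
  obtain ⟨P₂, hP₂, hd₂, ⟨C₂, hC₂⟩, hb₂, ht₂⟩ := exists_primitive hi₂
  rw [← inner_eq_integral hu₁ (EventuallyEq.refl _ _)] at ht₁
  rw [← inner_eq_integral hu₂ (EventuallyEq.refl _ _)] at ht₂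
  simp only [hr₁] at hd₁
  simp only [hr₂] at hd₂
  -- The solution is `y = w₁ P₂ - w₂ P₁` with `P_j' = w_j F` and `P_j = 0` at `-∞`. It is square
  -- integrable because the `P_j` are bounded, and `[w_j, y] = -P_j` yields the boundary values.
  have hy : LocAC fun x => w₁ x * P₂ x - w₂ x * P₁ x :=
    (h₁.regular.locAC.mul hP₂).sub (h₂.regular.locAC.mul hP₁)
  have hy' : LocAC fun x => deriv w₁ x * P₂ x - deriv w₂ x * P₁ x :=
    (h₁.regular.locAC_deriv.mul hP₂).sub (h₂.regular.locAC_deriv.mul hP₁)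
  -- The terms `w₁ w₂ F` cancel, so the derivative agrees almost everywhere with a continuous
  -- function and `y` is differentiable everywhere.
  have hD := hy.hasDerivAt hy'.continuous (by
    filter_upwards [hd₁, hd₂] with x e1 e2
    have h := ((h₁.regular.differentiable x).hasDerivAt.mul e2).sub
      ((h₂.regular.differentiable x).hasDerivAt.mul e1)
    have e : deriv w₁ x * P₂ x - deriv w₂ x * P₁ x = deriv w₁ x * P₂ x + w₁ x * (w₂ x * F x) -
        (deriv w₂ x * P₁ x + w₂ x * (w₁ x * F x)) := by ring
    rw [e]
    exact h)
  have hderiv : deriv (fun x => w₁ x * P₂ x - w₂ x * P₁ x) =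
      fun x => deriv w₁ x * P₂ x - deriv w₂ x * P₁ x := funext fun x => (hD x).deriv
  have htau : F =ᵐ[volume] tau q fun x => w₁ x * P₂ x - w₂ x * P₁ x := by
    filter_upwards [hd₁, hd₂, h₁.regular.locAC_deriv.ae_differentiableAt,
      h₂.regular.locAC_deriv.ae_differentiableAt, hw.solution₁.tau_ae_eq, hw.solution₂.tau_ae_eq]
      with x e1 e2 e3 e4 t1 t2
    have h := ((e3.hasDerivAt.mul e2).sub (e4.hasDerivAt.mul e1)).deriv
    have h' : deriv (fun x => deriv w₁ x * P₂ x - deriv w₂ x * P₁ x) x = _ := h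
    simp only [tau, Pi.zero_apply] at t1 t2
    rw [tau, hderiv, h']
    linear_combination (-P₂ x) * t1 + P₁ x * t2 - F x * hw.wronskian x
  have hB₁ : bracket w₁ (fun x => w₁ x * P₂ x - w₂ x * P₁ x) = fun x => -P₁ x := by
    funext x
    rw [bracket_of_real h₁.regular.differentiable hw.real₁, hderiv]
    linear_combination (-P₁ x) * hw.wronskian x
  have hB₂ : bracket w₂ (fun x => w₁ x * P₂ x - w₂ x * P₁ x) = fun x => -P₂ x := by
    funext x
    rw [bracket_of_real h₂.regular.differentiable hw.real₂, hderiv]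
    linear_combination (-P₂ x) * hw.wronskian x
  refine ⟨fun x => w₁ x * P₂ x - w₂ x * P₁ x, ⟨⟨fun x => (hD x).differentiableAt, ?_⟩, ?_, ?_⟩,
    htau, ?_, ?_, ?_, ?_⟩
  · rw [hderiv]
    exact hy'
  · exact (memLp_mul_of_bounded h₁.memLp hP₂.continuous hC₂).sub
      (memLp_mul_of_bounded h₂.memLp hP₁.continuous hC₁)
  · exact (Lp.memLp F).ae_eq htau
  · rw [hB₁]
    simpa using hb₁.neg
  · rw [hB₂]
    simpa using hb₂.neg
  · rw [hB₁]
    simpa using ht₁.neg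
  · rw [hB₂]
    simpa using ht₂.neg

/-- Brackets of two solutions are constant, so combinations of `w₁` and `w₂` have equal values at
both ends: they adjust `α` without changing `β - α`. -/
theorem IsSolutionPair.boundaryValues₁ (hw : IsSolutionPair q w₁ w₂) :
    HasBoundaryValues w₁ w₂ w₁ (![0, -1], ![0, -1]) := by
  have h1 : bracket w₁ w₁ = fun _ => 0 := by
    funext x
    rw [bracket_of_real hw.solution₁.regular.differentiable hw.real₁]
    ring
  have h2 : bracket w₂ w₁ = fun _ => -1 := by
    funext x
    rw [bracket_of_real hw.solution₂.regular.differentiable hw.real₂]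
    linear_combination -hw.wronskian x
  constructor <;> simp [h1, h2]

theorem IsSolutionPair.boundaryValues₂ (hw : IsSolutionPair q w₁ w₂) :
    HasBoundaryValues w₁ w₂ w₂ (![1, 0], ![1, 0]) := by
  have h1 : bracket w₁ w₂ = fun _ => 1 := funext hw.bracket_eq_one
  have h2 : bracket w₂ w₂ = fun _ => 0 := by
    funext x
    rw [bracket_of_real hw.solution₂.regular.differentiable hw.real₂]
    ring
  constructor <;> simp [h1, h2]

/-- The product of an odd and an even function integrates to zero. This is where parity enters; it
makes the Gram matrix of `w₁, w₂` diagonal. -/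
theorem IsSolutionPair.inner_eq_zero (hw : IsSolutionPair q w₁ w₂) {u₁ u₂ : L2}
    (hu₁ : u₁ =ᵐ[volume] w₁) (hu₂ : u₂ =ᵐ[volume] w₂) : inner ℂ u₁ u₂ = 0 := by
  rw [inner_eq_integral hu₁ hu₂]
  have h := integral_neg_eq_self (fun x => star (w₁ x) * w₂ x) volume
  simp only [hw.odd₁, hw.even₂, star_neg, neg_mul, integral_neg] at h
  linear_combination -h / 2

/-- Neither function can vanish identically, as their bracket is 1. -/
theorem IsSolutionPair.inner_self_ne_zero (hw : IsSolutionPair q w₁ w₂) {u₁ u₂ : L2}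
    (hu₁ : u₁ =ᵐ[volume] w₁) (hu₂ : u₂ =ᵐ[volume] w₂) :
    inner ℂ u₁ u₁ ≠ 0 ∧ inner ℂ u₂ u₂ ≠ 0 := by
  have key : ∀ {u : L2} {w : ℝ → ℂ}, Continuous w → u =ᵐ[volume] w → u = 0 → w = 0 := by
    intro u w hc hu h0
    rw [h0] at hu
    exact (Continuous.ae_eq_iff_eq volume hc continuous_zero).1
      (hu.symm.trans (Lp.coeFn_zero _ _ _))
  rw [Ne, Ne, inner_self_eq_zero, inner_self_eq_zero]
  have h := hw.bracket_eq_one 0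
  constructor <;> intro h0
  · rw [key hw.solution₁.regular.locAC.continuous hu₁ h0, bracket] at h
    simp [deriv_zero] at h
  · rw [key hw.solution₂.regular.locAC.continuous hu₂ h0, bracket_zero] at h
    simp at h

/-- All boundary values are attained. -/
theorem IsSolutionPair.exists_boundaryValues (hw : IsSolutionPair q w₁ w₂) (h₁ : MaxDomain q w₁)
    (h₂ : MaxDomain q w₂) (z : (Fin 2 → ℂ) × (Fin 2 → ℂ)) :
    ∃ y, MaxDomain q y ∧ HasBoundaryValues w₁ w₂ y z := by
  have hu₁ := h₁.memLp.coeFn_toLp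
  have hu₂ := h₂.memLp.coeFn_toLp
  set u₁ := h₁.memLp.toLp
  set u₂ := h₂.memLp.toLp
  have h12 := hw.inner_eq_zero hu₁ hu₂
  have h21 : inner ℂ u₂ u₁ = 0 := inner_eq_zero_symm.1 h12
  obtain ⟨h11, h22⟩ := hw.inner_self_ne_zero hu₁ hu₂
  -- The right-hand side `F` is chosen with `⟨u_j, F⟩ = α_j - β_j`, so `y` has boundary values `(0,
  -- β - α)`; the combination of `w₁, w₂` added below has `(α, α)`.
  obtain ⟨y, hy, -, hyz⟩ := hw.exists_tau_eq h₁ h₂ hu₁ hu₂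
    (((z.1 0 - z.2 0) / inner ℂ u₁ u₁) • u₁ + ((z.1 1 - z.2 1) / inner ℂ u₂ u₂) • u₂)
  have hs := (h₁.smul (-z.1 1)).add (h₂.smul (z.1 0))
  refine ⟨_, hs.add hy, ?_⟩
  have hb := ((hw.boundaryValues₁.smul h₁.regular (-z.1 1)).add (h₁.smul _).regular
    (h₂.smul _).regular (hw.boundaryValues₂.smul h₂.regular (z.1 0))).add hs.regular hy.regular hyz
  convert hb using 1
  refine Prod.ext (funext fun i => ?_) (funext fun i => ?_) <;> fin_cases i <;>
    simp [inner_add_right, inner_smul_right, h12, h21, div_mul_cancel₀ _ h11,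
      div_mul_cancel₀ _ h22, -inner_self_eq_norm_sq_to_K]

/-! ### Self-adjointness in terms of the boundary form -/

theorem mem_graph_extension {B : Submodule ℂ ((Fin 2 → ℂ) × (Fin 2 → ℂ))} {u u' : L2} :
    (u, u') ∈ (extension q w₁ w₂ B).graph ↔ ∃ y, MaxDomain q y ∧ u =ᵐ[volume] y ∧
      u' =ᵐ[volume] tau q y ∧ ∃ z ∈ B, HasBoundaryValues w₁ w₂ y z := by
  constructor
  · intro h
    have h1 : (u, u') ∈ maxGraph q := by
      rw [← maxOp_graph]
      exact LinearPMap.le_graph_of_le LinearPMap.domRestrict_le h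
    obtain ⟨y, hy, hu, hu'⟩ := h1
    have h2 : u ∈ boundaryDomain q w₁ w₂ B := (LinearPMap.mem_domain_of_mem_graph h).1
    obtain ⟨y', hy', hu2, hz⟩ := h2
    -- An `L²` class has at most one continuous representative, so the function giving the operator
    -- value and the one giving the boundary values coincide.
    have : y' = y := (Continuous.ae_eq_iff_eq volume hy'.regular.locAC.continuous
      hy.regular.locAC.continuous).1 (hu2.symm.trans hu)
    exact ⟨y, hy, hu, hu', this ▸ hz⟩
  · rintro ⟨y, hy, hu, hu', hz⟩
    have h1 : (u, u') ∈ (maxOp q).graph := by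
      rw [maxOp_graph]
      exact ⟨y, hy, hu, hu'⟩
    rw [LinearPMap.mem_graph_iff] at h1 ⊢
    obtain ⟨⟨x, hx⟩, rfl, h2⟩ := h1
    exact ⟨⟨x, ⟨y, hy, hu, hz⟩, hx⟩, rfl, h2⟩

/-- Functions orthogonal to the range of the minimal operator solve `τ_q(y) = 0`. -/
theorem IsSolutionPair.exists_combination (hw : IsSolutionPair q w₁ w₂) (h₁ : MaxDomain q w₁)
    (h₂ : MaxDomain q w₂) {v : L2}
    (hv : ∀ y, MaxDomain q y → HasBoundaryValues w₁ w₂ y 0 → ∀ F : L2, F =ᵐ[volume] tau q y →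
      inner ℂ F v = 0) :
    ∃ y, MaxDomain q y ∧ v =ᵐ[volume] y ∧ tau q y =ᵐ[volume] 0 := by
  have hu₁ := h₁.memLp.coeFn_toLp
  have hu₂ := h₂.memLp.coeFn_toLp
  set u₁ := h₁.memLp.toLp
  set u₂ := h₂.memLp.toLp
  have : FiniteDimensional ℂ (Submodule.span ℂ {u₁, u₂}) :=
    FiniteDimensional.span_of_finite ℂ (Set.toFinite _)
  have hmem : v ∈ Submodule.span ℂ {u₁, u₂} := by
    -- If `F` is orthogonal to `u₁, u₂`, variation of constants gives `F = τ_q(y)` with zero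
    -- boundary values, so `F ⊥ v`. Thus `v` lies in the double complement of the span, which is the
    -- span itself by finite dimension.
    rw [← Submodule.orthogonal_orthogonal (Submodule.span ℂ {u₁, u₂}), Submodule.mem_orthogonal]
    intro F hF
    rw [Submodule.mem_orthogonal] at hF
    obtain ⟨y, hy, hyF, hyz⟩ := hw.exists_tau_eq h₁ h₂ hu₁ hu₂ F
    refine hv y hy ?_ F hyF
    rw [hF u₁ (Submodule.subset_span (by simp)), hF u₂ (Submodule.subset_span (by simp))] at hyz
    convert hyz using 1
    refine Prod.ext rfl (funext fun i => ?_)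
    fin_cases i <;> simp
  obtain ⟨a, b, rfl⟩ := Submodule.mem_span_pair.1 hmem
  refine ⟨a • w₁ + b • w₂, (h₁.smul a).add (h₂.smul b), ?_, ?_⟩
  · exact (Lp.coeFn_add _ _).trans (((Lp.coeFn_smul a u₁).trans (hu₁.const_smul a)).add
      ((Lp.coeFn_smul b u₂).trans (hu₂.const_smul b)))
  · filter_upwards [tau_add (q := q) (h₁.smul a).regular (h₂.smul b).regular,
      tau_smul (q := q) h₁.regular a, tau_smul (q := q) h₂.regular b, hw.solution₁.tau_ae_eq,
      hw.solution₂.tau_ae_eq] with x e1 e2 e3 e4 e5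
    rw [e1, Pi.add_apply, e2, e3, Pi.smul_apply, Pi.smul_apply, e4, e5]
    simp

/-- Let `h` be orthogonal to the domain and write `h = τ_q(y)`. Green's formula against `f` with
zero boundary values gives `⟨τ_q(f), y⟩ = ⟨f, h⟩ = 0`, so `y` solves the homogeneous equation by
`exists_combination`, and `h = 0`. -/
theorem IsSolutionPair.dense_domain (hw : IsSolutionPair q w₁ w₂) (h₁ : MaxDomain q w₁)
    (h₂ : MaxDomain q w₂) (B : Submodule ℂ ((Fin 2 → ℂ) × (Fin 2 → ℂ))) :
    Dense ((extension q w₁ w₂ B).domain : Set L2) := by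
  rw [Submodule.dense_iff_topologicalClosure_eq_top, Submodule.topologicalClosure_eq_top_iff,
    Submodule.eq_bot_iff]
  intro h hh
  rw [Submodule.mem_orthogonal] at hh
  obtain ⟨y, hy, hyh, hyz⟩ := hw.exists_tau_eq h₁ h₂ h₁.memLp.coeFn_toLp h₂.memLp.coeFn_toLp h
  obtain ⟨y', hy', e1, e2⟩ := hw.exists_combination h₁ h₂ (v := hy.memLp.toLp) (by
    intro f hf hfz F hF
    have hg := hw.green hf hy hf.memLp.coeFn_toLp hF hy.memLp.coeFn_toLp hyh hfz hyz
    have hm : hf.memLp.toLp ∈ (extension q w₁ w₂ B).domain :=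
      LinearPMap.mem_domain_of_mem_graph
        (mem_graph_extension.2 ⟨f, hf, hf.memLp.coeFn_toLp, hF, 0, B.zero_mem, hfz⟩)
    rw [hh _ hm] at hg
    simpa [boundaryForm] using hg)
  have : y = y' := (Continuous.ae_eq_iff_eq volume hy.regular.locAC.continuous
    hy'.regular.locAC.continuous).1 (hy.memLp.coeFn_toLp.symm.trans e1)
  rw [Lp.eq_zero_iff_ae_eq_zero]
  exact hyh.trans (this ▸ e2)

/-- The adjoint of an extension is the extension given by the complement of the boundary space
with respect to the boundary form. -/
theorem IsSolutionPair.mem_adjoint_graph (hw : IsSolutionPair q w₁ w₂) (h₁ : MaxDomain q w₁)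
    (h₂ : MaxDomain q w₂) (B : Submodule ℂ ((Fin 2 → ℂ) × (Fin 2 → ℂ))) {v v' : L2} :
    (v, v') ∈ (extension q w₁ w₂ B).adjoint.graph ↔ ∃ y, MaxDomain q y ∧ v =ᵐ[volume] y ∧
      v' =ᵐ[volume] tau q y ∧ ∃ z, HasBoundaryValues w₁ w₂ y z ∧ ∀ z' ∈ B, boundaryForm z' z = 0 := by
  rw [LinearPMap.adjoint_graph_eq_graph_adjoint (hw.dense_domain h₁ h₂ B),
    Submodule.mem_adjoint_iff]
  constructor
  · intro h
    obtain ⟨y, hy, hyv, hyz⟩ := hw.exists_tau_eq h₁ h₂ h₁.memLp.coeFn_toLp h₂.memLp.coeFn_toLp v'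
    -- With `v' = τ_q(y)`, the difference `v - y` is orthogonal to the range of the minimal
    -- operator, hence a homogeneous solution; this puts `v` in `D_max`.
    obtain ⟨y', hy', e1, e2⟩ := hw.exists_combination h₁ h₂ (v := v - hy.memLp.toLp) (by
      intro f hf hfz F hF
      have hg := hw.green hf hy hf.memLp.coeFn_toLp hF hy.memLp.coeFn_toLp hyv hfz hyz
      have hm := h _ _ (mem_graph_extension.2 ⟨f, hf, hf.memLp.coeFn_toLp, hF, 0, B.zero_mem, hfz⟩)
      simp only [boundaryForm, Prod.fst_zero, Prod.snd_zero, Pi.zero_apply, star_zero, zero_mul,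
        sub_zero] at hg
      rw [inner_sub_right]
      linear_combination hm - hg)
    have hs := hy'.add hy
    have hv : v =ᵐ[volume] y' + y := by
      filter_upwards [Lp.coeFn_sub v hy.memLp.toLp, e1, hy.memLp.coeFn_toLp] with x a b c
      rw [Pi.add_apply, ← b, a, Pi.sub_apply, c]
      ring
    have hv' : v' =ᵐ[volume] tau q (y' + y) := by
      filter_upwards [hyv, tau_add (q := q) hy'.regular hy.regular, e2] with x a b c
      rw [b, Pi.add_apply, c, a, Pi.zero_apply, zero_add]
    obtain ⟨z, hz⟩ := hs.exists_boundaryValues h₁ h₂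
    refine ⟨_, hs, hv, hv', z, hz, fun z' hz' => ?_⟩
    -- Each element of `B` is attained by some `f` in the domain, so the adjoint relation for `f` is
    -- the vanishing of the form.
    obtain ⟨f, hf, hfz⟩ := hw.exists_boundaryValues h₁ h₂ z'
    rw [← hw.green hf hs hf.memLp.coeFn_toLp hf.memLp_tau.coeFn_toLp hv hv' hfz hz]
    exact h _ _ (mem_graph_extension.2
      ⟨f, hf, hf.memLp.coeFn_toLp, hf.memLp_tau.coeFn_toLp, z', hz', hfz⟩)
  · rintro ⟨y, hy, hv, hv', z, hz, hB⟩ u u' hu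
    obtain ⟨f, hf, e1, e2, z', hz', hfz⟩ := mem_graph_extension.1 hu
    rw [hw.green hf hy e1 e2 hv hv' hfz hz, hB z' hz']

/-- Boundary values are unique and all of them are attained, so equality of the graphs of the
operator and its adjoint is equality of `B` and its complement. -/
theorem IsSolutionPair.isSelfAdjoint_extension_iff (hw : IsSolutionPair q w₁ w₂)
    (hlc : LimitCircle q) (B : Submodule ℂ ((Fin 2 → ℂ) × (Fin 2 → ℂ))) :
    IsSelfAdjoint (extension q w₁ w₂ B) ↔ ∀ z, z ∈ B ↔ ∀ z' ∈ B, boundaryForm z' z = 0 := by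
  have h₁ := hw.solution₁.maxDomain hlc
  have h₂ := hw.solution₂.maxDomain hlc
  rw [LinearPMap.isSelfAdjoint_def]
  constructor
  · intro h z
    obtain ⟨y, hy, hyz⟩ := hw.exists_boundaryValues h₁ h₂ z
    have hu := hy.memLp.coeFn_toLp
    have hu' := hy.memLp_tau.coeFn_toLp
    have e := hw.mem_adjoint_graph h₁ h₂ B (v := hy.memLp.toLp) (v' := hy.memLp_tau.toLp)
    have huniq : ∀ y', MaxDomain q y' → hy.memLp.toLp =ᵐ[volume] y' → y' = y := fun y' hy' h' =>
      (Continuous.ae_eq_iff_eq volume hy'.regular.locAC.continuous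
        hy.regular.locAC.continuous).1 (h'.symm.trans hu)
    rw [h, mem_graph_extension] at e
    constructor
    · intro hz
      obtain ⟨y', hy', h3, -, z', hz', h4⟩ := e.1 ⟨y, hy, hu, hu', z, hz, hyz⟩
      rw [huniq y' hy' h3] at hz'
      rwa [hyz.unique hz']
    · intro hz
      obtain ⟨y', hy', h3, -, z', hz', h4⟩ := e.2 ⟨y, hy, hu, hu', z, hyz, hz⟩
      rw [huniq y' hy' h3] at h4
      rwa [hyz.unique h4]
  · intro h
    refine LinearPMap.eq_of_eq_graph ?_
    ext ⟨v, v'⟩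
    rw [hw.mem_adjoint_graph h₁ h₂, mem_graph_extension]
    simp only [← h, and_comm]

/-! ### Separated boundary conditions -/

/-- As `a * star b` is real, the line `a x + b y = 0` is spanned by a real vector, on which the skew
form vanishes. -/
theorem line_isotropic {a b x y x' y' : ℂ} (h : a ≠ 0 ∨ b ≠ 0) (hab : a * star b = star a * b)
    (h1 : a * x + b * y = 0) (h2 : a * x' + b * y' = 0) : star x' * y - star y' * x = 0 := by
  have h3 : star a * star x' + star b * star y' = 0 := by
    rw [← star_mul', ← star_mul', ← star_add, h2, star_zero]
  rcases h with h | h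
  · refine (mul_eq_zero.1 ?_).resolve_left (mul_ne_zero h (star_ne_zero.2 h))
    linear_combination a * y * h3 - star a * star y' * h1 - y * star y' * hab
  · refine (mul_eq_zero.1 ?_).resolve_left (mul_ne_zero h (star_ne_zero.2 h))
    linear_combination star b * star x' * h1 - b * x * h3 - x * star x' * hab

/-- As `a * star b` is real, `(star a, star b)` is proportional to `(a, b)`. -/
theorem line_maximal {a b x y : ℂ} (h : a ≠ 0 ∨ b ≠ 0) (hab : a * star b = star a * b)
    (h1 : star a * x + star b * y = 0) : a * x + b * y = 0 := by
  rcases h with h | h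
  · refine (mul_eq_zero.1 ?_).resolve_left (star_ne_zero.2 h)
    linear_combination a * h1 - y * hab
  · refine (mul_eq_zero.1 ?_).resolve_left (star_ne_zero.2 h)
    linear_combination b * h1 + x * hab

/-- The form does not couple the two ends, and the lines are spanned by `(b, -a)` and `(d, -c)`.
Testing each spanning vector against itself gives necessity; testing `z` against it gives the
conjugated equation needed in `line_maximal`. -/
theorem separatedBC_lagrangian_iff {a b c d : ℂ} (hab : a ≠ 0 ∨ b ≠ 0) (hcd : c ≠ 0 ∨ d ≠ 0) :
    (∀ z, z ∈ separatedBC a b c d ↔ ∀ z' ∈ separatedBC a b c d, boundaryForm z' z = 0) ↔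
      a * star b = star a * b ∧ c * star d = star c * d := by
  have hm : ∀ z, z ∈ separatedBC a b c d ↔ a * z.1 0 + b * z.1 1 = 0 ∧
      c * z.2 0 + d * z.2 1 = 0 := fun _ => Iff.rfl
  have m1 : ((![b, -a], 0) : (Fin 2 → ℂ) × (Fin 2 → ℂ)) ∈ separatedBC a b c d := by
    rw [hm]
    constructor <;> simp
    ring
  have m2 : ((0, ![d, -c]) : (Fin 2 → ℂ) × (Fin 2 → ℂ)) ∈ separatedBC a b c d := by
    rw [hm]
    constructor <;> simp
    ring
  constructor
  · intro h
    have h1 := (h _).1 m1 _ m1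
    have h2 := (h _).1 m2 _ m2
    simp only [boundaryForm, Matrix.cons_val_zero, Matrix.cons_val_one, Pi.zero_apply, star_zero,
      star_neg] at h1 h2
    constructor
    · linear_combination h1
    · linear_combination -h2
  · rintro ⟨h1, h2⟩ z
    constructor
    · intro hz z' hz'
      rw [boundaryForm, line_isotropic hab h1 hz.1 hz'.1, line_isotropic hcd h2 hz.2 hz'.2, sub_zero]
    · intro hz
      have e1 := hz _ m1
      have e2 := hz _ m2
      simp only [boundaryForm, Matrix.cons_val_zero, Matrix.cons_val_one, Pi.zero_apply, star_zero,
        star_neg] at e1 e2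
      exact ⟨line_maximal hab h1 (by linear_combination -e1),
        line_maximal hcd h2 (by linear_combination e2)⟩

theorem cos_sin_ne_zero {ξ : ℂ} (hξ : ‖ξ‖ = 1) (α : ℝ) :
    ξ * (Real.cos α : ℂ) ≠ 0 ∨ -(Real.sin α : ℂ) ≠ 0 := by
  by_contra! h
  have h0 : ξ ≠ 0 := by
    rintro rfl
    simp at hξ
  have h1 : Real.cos α = 0 := by simpa [h0, -Complex.ofReal_cos] using h.1
  have h2 : Real.sin α = 0 := by simpa [-Complex.ofReal_sin] using h.2
  simpa [h1, h2] using Real.sin_sq_add_cos_sq α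

theorem star_eq_self_iff_of_norm_one {ξ : ℂ} (hξ : ‖ξ‖ = 1) : star ξ = ξ ↔ ξ = 1 ∨ ξ = -1 := by
  constructor
  · intro h
    have h1 : ξ * star ξ = 1 := by
      rw [RCLike.star_def, Complex.mul_conj, Complex.normSq_eq_norm_sq, hξ]
      simp
    rw [h] at h1
    exact mul_self_eq_one_iff.1 h1
  · rintro (rfl | rfl) <;> simp

/-- The difference of the two sides is `sin α cos α (star ξ - ξ)`. -/
theorem normSeparated_real_iff {ξ : ℂ} (hξ : ‖ξ‖ = 1) (α : ℝ) :
    ξ * (Real.cos α : ℂ) * star (-(Real.sin α : ℂ)) = star (ξ * (Real.cos α : ℂ)) *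
      -(Real.sin α : ℂ) ↔ Real.sin α * Real.cos α = 0 ∨ ξ = 1 ∨ ξ = -1 := by
  rw [← star_eq_self_iff_of_norm_one hξ, ← sub_eq_zero (a := star ξ)]
  have e1 : star (Real.cos α : ℂ) = Real.cos α := Complex.conj_ofReal _
  have e2 : star (Real.sin α : ℂ) = Real.sin α := Complex.conj_ofReal _
  rw [← Complex.ofReal_eq_zero, ← mul_eq_zero, star_neg, star_mul', e1, e2, Complex.ofReal_mul]
  constructor <;> intro h <;> linear_combination h

theorem IsSolutionPair.isSelfAdjoint_normSeparatedBC_iff (hw : IsSolutionPair q w₁ w₂)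
    (hlc : LimitCircle q) {ξ η : ℂ} (hξ : ‖ξ‖ = 1) (hη : ‖η‖ = 1) (α β : ℝ) :
    IsSelfAdjoint (extension q w₁ w₂ (normSeparatedBC ξ η α β)) ↔
      (Real.sin α * Real.cos α = 0 ∨ ξ = 1 ∨ ξ = -1) ∧
        (Real.sin β * Real.cos β = 0 ∨ η = 1 ∨ η = -1) := by
  rw [hw.isSelfAdjoint_extension_iff hlc, normSeparatedBC,
    separatedBC_lagrangian_iff (cos_sin_ne_zero hξ α) (cos_sin_ne_zero hη β),
    normSeparated_real_iff hξ, normSeparated_real_iff hη]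

theorem Normalized.iff_eq_one {ξ : ℂ} {α : ℝ} (h : Normalized ξ α) :
    (Real.sin α * Real.cos α = 0 ∨ ξ = 1 ∨ ξ = -1) ↔ ξ = 1 := by
  constructor
  · rintro (h' | h' | h')
    exacts [h.1 h', h', (h.2 h').elim]
  · exact fun h' => Or.inr (Or.inl h')

/-- A polar form with signed modulus: for negative real `w` the sign goes into `t`, which keeps `ξ`
away from `-1`. -/
theorem exists_polar {w : ℂ} (hw : w ≠ 0) :
    ∃ (ξ : ℂ) (t : ℝ), ‖ξ‖ = 1 ∧ ξ ≠ -1 ∧ t ≠ 0 ∧ w = ξ * t := by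
  have hn : ‖w‖ ≠ 0 := norm_ne_zero_iff.2 hw
  have hn' : (‖w‖ : ℂ) ≠ 0 := Complex.ofReal_ne_zero.2 hn
  by_cases h : w / ‖w‖ = -1
  · refine ⟨1, -‖w‖, by simp, ?_, neg_ne_zero.2 hn, ?_⟩
    · norm_num
    · rw [div_eq_iff hn'] at h
      rw [h]
      push_cast
      simp
  · refine ⟨w / ‖w‖, ‖w‖, ?_, h, hn, (div_mul_cancel₀ _ hn').symm⟩
    rw [norm_div, Complex.norm_real, norm_norm, div_self hn]

theorem exists_normalized {a b : ℂ} (h : a ≠ 0 ∨ b ≠ 0) :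
    ∃ ξ : ℂ, ∃ α ∈ Set.Ico 0 (2 * Real.pi), ‖ξ‖ = 1 ∧ Normalized ξ α ∧
      ∃ s : ℂ, s ≠ 0 ∧ a = s * (ξ * (Real.cos α : ℂ)) ∧ b = s * -(Real.sin α : ℂ) := by
  have hpi := Real.pi_pos
  have h1 : (1 : ℂ) ≠ -1 := by norm_num
  by_cases ha : a = 0
  · exact ⟨1, Real.pi / 2, ⟨by linarith, by linarith⟩, by simp, ⟨fun _ => rfl, h1⟩, -b,
      by simpa [ha] using h, by simp [ha], by simp⟩
  by_cases hb : b = 0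
  · exact ⟨1, 0, ⟨le_rfl, by linarith⟩, by simp, ⟨fun _ => rfl, h1⟩, a, ha, by simp, by simp [hb]⟩
  -- The two required equations force `-a / b = ξ cot α`. Hence `t = cot α`, and `α = π/2 - arctan
  -- t` lies in `(0, π)`; since `t ≠ 0`, neither `sin α` nor `cos α` vanishes.
  obtain ⟨ξ, t, hξ, hξ1, ht, hw⟩ := exists_polar (div_ne_zero (neg_ne_zero.2 ha) hb)
  have hs : Real.sin (Real.pi / 2 - Real.arctan t) ≠ 0 := by
    rw [Real.sin_pi_div_two_sub]
    exact (Real.cos_arctan_pos t).ne'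
  have hc : Real.cos (Real.pi / 2 - Real.arctan t) =
      t * Real.sin (Real.pi / 2 - Real.arctan t) := by
    rw [Real.sin_pi_div_two_sub, Real.cos_pi_div_two_sub]
    conv_rhs => rw [← Real.tan_arctan t, Real.arctan_tan (Real.neg_pi_div_two_lt_arctan t)
      (Real.arctan_lt_pi_div_two t)]
    exact (Real.tan_mul_cos (Real.cos_arctan_pos t).ne').symm
  have hs' : (Real.sin (Real.pi / 2 - Real.arctan t) : ℂ) ≠ 0 := Complex.ofReal_ne_zero.2 hs
  refine ⟨ξ, Real.pi / 2 - Real.arctan t, ⟨?_, ?_⟩, hξ, ⟨fun h0 => ?_, hξ1⟩,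
    -b / (Real.sin (Real.pi / 2 - Real.arctan t) : ℂ), div_ne_zero (neg_ne_zero.2 hb) hs', ?_, ?_⟩
  · linarith [Real.arctan_lt_pi_div_two t]
  · linarith [Real.neg_pi_div_two_lt_arctan t]
  · rw [hc] at h0
    exact absurd h0 (mul_ne_zero hs (mul_ne_zero ht hs))
  · rw [div_eq_iff hb] at hw
    rw [hc, Complex.ofReal_mul]
    rw [div_mul_eq_mul_div, eq_div_iff hs']
    linear_combination (-(Real.sin (Real.pi / 2 - Real.arctan t) : ℂ)) * hw
  · rw [div_mul_eq_mul_div, eq_div_iff hs']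
    ring

theorem separatedBC_smul {a b c d s t : ℂ} (hs : s ≠ 0) (ht : t ≠ 0) :
    separatedBC (s * a) (s * b) (t * c) (t * d) = separatedBC a b c d := by
  ext z
  show (s * a * z.1 0 + s * b * z.1 1 = 0 ∧ t * c * z.2 0 + t * d * z.2 1 = 0) ↔
    (a * z.1 0 + b * z.1 1 = 0 ∧ c * z.2 0 + d * z.2 1 = 0)
  rw [mul_assoc, mul_assoc, ← mul_add, mul_assoc, mul_assoc, ← mul_add, mul_eq_zero_iff_left hs,
    mul_eq_zero_iff_left ht]

/-! ### Mixed boundary conditions -/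

/-- The matrix `M` with entries `a, b, c, d` satisfies `M* J M = J`. -/
structure PreservesForm (a b c d : ℂ) : Prop where
  fst : star a * c = star c * a
  snd : star b * d = star d * b
  mixed : star a * d - star c * b = 1

theorem PreservesForm.mixed' {a b c d : ℂ} (h : PreservesForm a b c d) :
    star d * a - star b * c = 1 := by
  have := congrArg star h.mixed
  simp only [star_sub, star_mul', star_star, star_one] at this
  linear_combination this

/-- `M* J M = J` implies `M J M* = J`. -/
theorem PreservesForm.transpose {a b c d : ℂ} (h : PreservesForm a b c d) :
    a * star d - b * star c = 1 ∧ a * star b = b * star a ∧ c * star d = d * star c ∧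
      d * star a - c * star b = 1 := by
  -- The left factor is `J⁻¹ M* J`; a left inverse of a square matrix is also a right inverse.
  have h1 : !![star d, -star b; -star c, star a] * !![a, b; c, d] = 1 := by
    rw [Matrix.mul_fin_two, Matrix.one_fin_two,
      show star d * a + -star b * c = 1 by linear_combination h.mixed',
      show star d * b + -star b * d = 0 by linear_combination -h.snd,
      show -star c * a + star a * c = 0 by linear_combination h.fst,
      show -star c * b + star a * d = 1 by linear_combination h.mixed]
  rw [mul_eq_one_comm, Matrix.mul_fin_two, Matrix.one_fin_two] at h1
  have e := fun i j => congrFun (congrFun h1 i) j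
  have e00 := e 0 0
  have e01 := e 0 1
  have e10 := e 1 0
  have e11 := e 1 1
  simp at e00 e01 e10 e11
  simp only [RCLike.star_def]
  refine ⟨?_, ?_, ?_, ?_⟩
  · linear_combination e00
  · linear_combination -e01
  · linear_combination e10
  · linear_combination e11

/-- Comparing `M⁻¹ = J⁻¹ M* J` with the adjugate formula shows that each entry satisfies `x = Δ *
star x`. With `|Δ| = 1` and `φ` half the argument of `Δ`, this says that `e^{-iφ} x` is its own
conjugate. -/
theorem PreservesForm.mixedCriterion {a b c d : ℂ} (h : PreservesForm a b c d) :
    MixedCriterion a b c d := by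
  obtain ⟨t1, t2, t3, t4⟩ := h.transpose
  have hd : (a * d - b * c) * star (a * d - b * c) = 1 := by
    simp only [star_sub, star_mul']
    linear_combination h.mixed + (star a * d - star c * b) * h.mixed' +
      (star b * d - star d * b) * h.fst
  have hn : ‖a * d - b * c‖ = 1 := by
    have := congrArg norm hd
    rw [norm_mul, norm_star, norm_one] at this
    nlinarith [norm_nonneg (a * d - b * c)]
  have hΔ : a * d - b * c = Complex.exp (2 * Complex.I * ((a * d - b * c).arg / 2 : ℝ)) := by
    have := Complex.norm_mul_exp_arg_mul_I (a * d - b * c)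
    rw [hn] at this
    conv_lhs => rw [← this]
    push_cast
    rw [one_mul]
    congr 1
    ring
  set φ : ℝ := (a * d - b * c).arg / 2
  have key : ∀ x : ℂ, x = (a * d - b * c) * star x →
      ∃ r : ℝ, Complex.exp (-Complex.I * φ) * x = r := by
    intro x hx
    have : star (Complex.exp (-Complex.I * φ) * x) = Complex.exp (-Complex.I * φ) * x := by
      conv_rhs => rw [hx, hΔ, ← mul_assoc, ← Complex.exp_add]
      rw [star_mul', RCLike.star_def, ← Complex.exp_conj]
      congr 2
      simp
      ring
    exact ⟨_, (Complex.conj_eq_iff_re.1 this).symm⟩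
  refine ⟨φ, hΔ, key a ?_, key b ?_, key c ?_, key d ?_⟩
  · linear_combination -a * t4 - c * t2
  · linear_combination -d * t2 - b * t4
  · linear_combination -c * t1 + a * t3
  · linear_combination -d * t1 + b * t3

/-- Here `M = e^{iφ} R` with `R` real of determinant 1. The phase cancels in `M* J M`, and `Rᵀ J R =
det R • J`. -/
theorem MixedCriterion.preservesForm {a b c d : ℂ} (h : MixedCriterion a b c d) :
    PreservesForm a b c d := by
  obtain ⟨φ, hΔ, ⟨r₁, h₁⟩, ⟨r₂, h₂⟩, ⟨r₃, h₃⟩, ⟨r₄, h₄⟩⟩ := h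
  have he : Complex.exp (-Complex.I * φ) * Complex.exp (Complex.I * φ) = 1 := by
    rw [← Complex.exp_add]
    simp
  have hs : star (Complex.exp (Complex.I * φ)) = Complex.exp (-Complex.I * φ) := by
    rw [RCLike.star_def, ← Complex.exp_conj]
    simp
  have h2 : Complex.exp (2 * Complex.I * φ) =
      Complex.exp (Complex.I * φ) * Complex.exp (Complex.I * φ) := by
    rw [← Complex.exp_add]
    congr 1
    ring
  set e := Complex.exp (Complex.I * φ)
  set e' := Complex.exp (-Complex.I * φ)
  have key : ∀ {x : ℂ} {r : ℝ}, e' * x = r → x = e * r ∧ star x = e' * r := by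
    intro x r hx
    have h0 : x = e * r := by linear_combination e * hx - x * he
    refine ⟨h0, ?_⟩
    rw [h0, star_mul', hs]
    congr 1
    exact Complex.conj_ofReal r
  obtain ⟨a1, a2⟩ := key h₁
  obtain ⟨b1, b2⟩ := key h₂
  obtain ⟨c1, c2⟩ := key h₃
  obtain ⟨d1, d2⟩ := key h₄
  rw [h2] at hΔ
  refine ⟨?_, ?_, ?_⟩
  · rw [a2, c2, c1, a1]
    ring
  · rw [b2, d2, d1, b1]
    ring
  · rw [a2, c2, d1, b1]
    rw [a1, b1, c1, d1] at hΔ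
    linear_combination e' * e' * hΔ + (1 + (1 - (r₁ * r₄ - r₂ * r₃)) * e * e') * he

theorem mem_mixedBC₁ {a b c d : ℂ} {z : (Fin 2 → ℂ) × (Fin 2 → ℂ)} :
    z ∈ mixedBC₁ !![a, b; c, d] ↔
      z.1 0 = a * z.2 0 + b * z.2 1 ∧ z.1 1 = c * z.2 0 + d * z.2 1 := by
  show z.1 = _ ↔ _
  simp [funext_iff, Fin.forall_fin_two, dotProduct, Fin.sum_univ_two]

/-- On the graph the form is that of `J - M* J M`. Vanishing against the graph vectors over the
standard basis means `M* J z.1 = J z.2`, and `M J M* = J` turns this into `z.1 = M z.2`. -/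
theorem mixedBC₁_lagrangian_iff {a b c d : ℂ} :
    (∀ z, z ∈ mixedBC₁ !![a, b; c, d] ↔
      ∀ z' ∈ mixedBC₁ !![a, b; c, d], boundaryForm z' z = 0) ↔ PreservesForm a b c d := by
  have m1 : ((![a, c], ![1, 0]) : (Fin 2 → ℂ) × (Fin 2 → ℂ)) ∈ mixedBC₁ !![a, b; c, d] := by
    simp [mem_mixedBC₁]
  have m2 : ((![b, d], ![0, 1]) : (Fin 2 → ℂ) × (Fin 2 → ℂ)) ∈ mixedBC₁ !![a, b; c, d] := by
    simp [mem_mixedBC₁]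
  constructor
  · intro h
    have h1 := (h _).1 m1 _ m1
    have h2 := (h _).1 m2 _ m2
    have h3 := (h _).1 m2 _ m1
    simp only [boundaryForm, Matrix.cons_val_zero, Matrix.cons_val_one, star_zero, star_one]
      at h1 h2 h3
    exact ⟨by linear_combination -h1, by linear_combination -h2, by linear_combination -h3⟩
  · intro h z
    constructor
    · intro hz z' hz'
      rw [mem_mixedBC₁] at hz hz'
      rw [boundaryForm, hz.1, hz.2, hz'.1, hz'.2]
      simp only [star_add, star_mul']
      linear_combination (-star (z'.2 0) * z.2 0) * h.fst - star (z'.2 1) * z.2 1 * h.snd -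
        star (z'.2 0) * z.2 1 * h.mixed + star (z'.2 1) * z.2 0 * h.mixed'
    · intro hz
      obtain ⟨t1, t2, t3, t4⟩ := h.transpose
      have e1 := hz _ m1
      have e2 := hz _ m2
      simp only [boundaryForm, Matrix.cons_val_zero, Matrix.cons_val_one, star_zero, star_one]
        at e1 e2
      rw [mem_mixedBC₁]
      constructor
      · linear_combination a * e2 - b * e1 - z.1 0 * t1 + z.1 1 * t2
      · linear_combination c * e2 - d * e1 - z.1 0 * t3 - z.1 1 * t4

/-- Exchanging the endpoints interchanges the two boundary spaces and changes only the sign of the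
form. -/
theorem mixedBC₂_lagrangian_iff {M : Matrix (Fin 2) (Fin 2) ℂ} :
    (∀ z, z ∈ mixedBC₂ M ↔ ∀ z' ∈ mixedBC₂ M, boundaryForm z' z = 0) ↔
      ∀ z, z ∈ mixedBC₁ M ↔ ∀ z' ∈ mixedBC₁ M, boundaryForm z' z = 0 := by
  have hf : ∀ z z', boundaryForm z'.swap z.swap = -boundaryForm z' z := by
    intro z z'
    simp only [boundaryForm, Prod.fst_swap, Prod.snd_swap]
    ring
  have hall : ∀ z, (∀ z' ∈ mixedBC₂ M, boundaryForm z' z.swap = 0) ↔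
      ∀ z' ∈ mixedBC₁ M, boundaryForm z' z = 0 := by
    refine fun z => ⟨fun h z' hz' => ?_, fun h z' hz' => ?_⟩
    · rw [← neg_eq_zero, ← hf]
      exact h z'.swap hz'
    · rw [← Prod.swap_swap z', hf, h z'.swap hz', neg_zero]
  exact ⟨fun h z => (h z.swap).trans (hall z), fun h z => (h z.swap).trans (hall z.swap).symm⟩

theorem preservesForm_iff {a b c d : ℂ} : PreservesForm a b c d ↔ MixedCriterion a b c d :=
  ⟨fun h => h.mixedCriterion, fun h => h.preservesForm⟩

end SturmLiouville

end

/-! ### The criteria for separated and mixed conditions -/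

theorem mainTheorem7 (q : ℝ → ℝ) (hq : LocallyIntegrable q volume) (hq_even : ∀ x, q (-x) = q x)
    (hlc : SturmLiouville.LimitCircle q) (w₁ w₂ : ℝ → ℂ)
    (hw : SturmLiouville.IsSolutionPair q w₁ w₂) :
    -- separated boundary conditions, arbitrary parameters
    (∀ ξ η : ℂ, ‖ξ‖ = 1 → ‖η‖ = 1 →
      ∀ α ∈ Set.Ico 0 (2 * Real.pi), ∀ β ∈ Set.Ico 0 (2 * Real.pi),
        (IsSelfAdjoint (SturmLiouville.extension q w₁ w₂
            (SturmLiouville.normSeparatedBC ξ η α β)) ↔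
          (Real.sin α * Real.cos α = 0 ∨ ξ = 1 ∨ ξ = -1) ∧
          (Real.sin β * Real.cos β = 0 ∨ η = 1 ∨ η = -1))) ∧
    -- separated boundary conditions, normalized parameters
    (∀ ξ η : ℂ, ‖ξ‖ = 1 → ‖η‖ = 1 →
      ∀ α ∈ Set.Ico 0 (2 * Real.pi), ∀ β ∈ Set.Ico 0 (2 * Real.pi),
        SturmLiouville.Normalized ξ α → SturmLiouville.Normalized η β →
        (IsSelfAdjoint (SturmLiouville.extension q w₁ w₂
            (SturmLiouville.normSeparatedBC ξ η α β)) ↔ ξ = 1 ∧ η = 1)) ∧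
    -- all separated boundary conditions can be normalized
    (∀ a b c d : ℂ, (a ≠ 0 ∨ b ≠ 0) → (c ≠ 0 ∨ d ≠ 0) →
      ∃ ξ η : ℂ, ∃ α ∈ Set.Ico 0 (2 * Real.pi), ∃ β ∈ Set.Ico 0 (2 * Real.pi),
        ‖ξ‖ = 1 ∧ ‖η‖ = 1 ∧
        SturmLiouville.Normalized ξ α ∧ SturmLiouville.Normalized η β ∧
        SturmLiouville.extension q w₁ w₂ (SturmLiouville.separatedBC a b c d) =
          SturmLiouville.extension q w₁ w₂ (SturmLiouville.normSeparatedBC ξ η α β)) ∧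
    -- mixed boundary conditions, of both forms
    (∀ a b c d : ℂ,
      (IsSelfAdjoint (SturmLiouville.extension q w₁ w₂
          (SturmLiouville.mixedBC₁ !![a, b; c, d])) ↔ SturmLiouville.MixedCriterion a b c d) ∧
      (IsSelfAdjoint (SturmLiouville.extension q w₁ w₂
          (SturmLiouville.mixedBC₂ !![a, b; c, d])) ↔ SturmLiouville.MixedCriterion a b c d)) := by
  refine ⟨fun ξ η hξ hη α _ β _ => hw.isSelfAdjoint_normSeparatedBC_iff hlc hξ hη α β,
    fun ξ η hξ hη α _ β _ h1 h2 => ?_, fun a b c d hab hcd => ?_, fun a b c d => ⟨?_, ?_⟩⟩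
  · rw [hw.isSelfAdjoint_normSeparatedBC_iff hlc hξ hη, h1.iff_eq_one, h2.iff_eq_one]
  · obtain ⟨ξ, α, hα, hξ, h1, s, hs, rfl, rfl⟩ := SturmLiouville.exists_normalized hab
    obtain ⟨η, β, hβ, hη, h2, t, ht, rfl, rfl⟩ := SturmLiouville.exists_normalized hcd
    refine ⟨ξ, η, α, hα, β, hβ, hξ, hη, h1, h2, ?_⟩
    rw [SturmLiouville.separatedBC_smul hs ht, SturmLiouville.normSeparatedBC]
  · rw [hw.isSelfAdjoint_extension_iff hlc, SturmLiouville.mixedBC₁_lagrangian_iff,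
      SturmLiouville.preservesForm_iff]
  · rw [hw.isSelfAdjoint_extension_iff hlc, SturmLiouville.mixedBC₂_lagrangian_iff,
      SturmLiouville.mixedBC₁_lagrangian_iff, SturmLiouville.preservesForm_iff]
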